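/- Let $\mathbb k$ be a field and let $\mathbf{dgVect}_{\mathbb k}$ be the category of differential $\mathbb Z$-graded vector spaces: objects are families $(V_n)_{n\in\mathbb Z}$ of $\mathbb k$-vector spaces with linear maps $d\colon V_n\to V_{n-1}$, $d^2=0$; morphisms are families of linear maps $V_n\to W_n$ commuting with $d$. Put $(U\otimes V)_n=\bigoplus_{p+q=n}U_p\otimes V_q$ with $d(u\otimes v)=du\otimes v+(-1)^{p}u\otimes dv$ for $u\in U_p$, and let the unit be $\mathbb k$ in degree $0$. A monomorphism $i$ is called extremal if in every factorization $i=f\pi$ with $\pi$ an epimorphism, $\pi$ is an isomorphism; extremal epimorphisms are defined dually. A category is (Epi, ExtrMono)-structured if every morphism factors as an epimorphism followed by an extremal monomorphism, and every commutative square with an epimorphism $\pi\colon P\to Q$ on one side and an extremal monomorphism $i\colon A\to B$ on the opposite side has a diagonal fill-in $Q\to A$; (ExtrEpi, Mono)-structured is the dual notion. Then $\mathcal C=\mathbf{dgVect}_{\mathbb k}$ is a symmetric monoidal category with the swap $u\otimes v\mapsto(-1)^{pq}\,v\otimes u$ for $u\in U_p$, $v\in V_q$, and it has the following properties: 1. $\mathcal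 C$ has all small limits; dually, all small colimits. 2. $\mathcal C$ has finite and countable colimits; dually, finite and countable limits. 3. $\mathcal C$ is (Epi, ExtrMono)-structured; dually, (ExtrEpi, Mono)-structured. 4. $\mathcal C$ is wellpowered and cowellpowered. 5. If $f$ is a monomorphism (respectively an epimorphism), then so are $f\otimes\mathrm{id}_M$ and $\mathrm{id}_M\otimes f$ for every object $M$. If $f$ is an extremal monomorphism (respectively an extremal epimorphism), then so is $f\otimes f$. 6. For every object $M$ the functor $M\otimes(-)$ preserves intersections (limits) of arbitrary families of extremal subobjects of an object; dually, $(-)\otimes M$ preserves colimits of arbitrary families of extremal quotient objects of an object. 7. For every object $M$ the functor $M\otimes(-)$ preserves pullbacks of monomorphisms along arbitrary morphisms; dually, $(-)\otimes M$ preserves pushouts of epimorphisms along arbitrary morphisms. 8. For every nonempty small set $\Lambda$ and all objects $M$, $A_\alpha$ ($\alpha\in\Lambda$), the canonical morphism $M\otimes\prod_\alpha A_\alpha\to\prod_\alpha(M\otimes A_\alpha)$ is a monomorphism; dually, the canonical morphism $\coprod_\alpha(A_\alpha\otimes M)\to\bigl(\coprod_\alpha A_\alpha\bigr)\otimes M$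 is an epimorphism. 9. For every object $M$ the functor $M\otimes(-)$ preserves all equalizers; dually, $(-)\otimes M$ preserves all coequalizers. 10. The forgetful functor $\mathsf{Mon}(\mathcal C)\to\mathcal C$ from monoids has a left adjoint (free monoids exist); dually, the forgetful functor $\mathsf{Comon}(\mathcal C)\to\mathcal C$ from comonoids has a right adjoint (cofree comonoids exist). Moreover, all monomorphisms and all epimorphisms in $\mathbf{dgVect}_{\mathbb k}$ are extremal. -/

import Mathlib

open CategoryTheory Limits MonoidalCategory

universe w v u

/-- The Koszul sign `i ↦ (-1)^i` for `ℤ`-indexed complexes whose differential lowers the degree by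
one. With it, Mathlib's tensor product of complexes has the summands `U_p ⊗ V_q` (`p + q = n`) in
degree `n` and the differential `d (u ⊗ v) = du ⊗ v + (-1)^p u ⊗ dv` for `u ∈ U_p`. -/
instance ComplexShape.tensorSignsDownInt : (ComplexShape.down ℤ).TensorSigns where
  ε' := MonoidHom.mk' Int.negOnePow Int.negOnePow_add
  rel_add p q r (hpq : q + 1 = p) := show (q + r) + 1 = p + r by omega
  add_rel p q r (hpq : q + 1 = p) := show (r + q) + 1 = r + p by omega
  ε'_succ p q (hpq : q + 1 = p) := show Int.negOnePow q = - Int.negOnePow p by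
    rw [← hpq, Int.negOnePow_succ, neg_neg]

/-- The category of differential `ℤ`-graded vector spaces over `k`: families `(V_n)_{n ∈ ℤ}` of
vector spaces with linear maps `d : V_n → V_{n-1}` such that `d² = 0`. Its monoidal structure is
Mathlib's `HomologicalComplex.monoidalCategory`. -/
abbrev DgVect (k : Type u) [Field k] : Type (u + 1) := ChainComplex (ModuleCat.{u} k) ℤ

section Properties

variable {C : Type u} [Category.{v} C]

/-- A monomorphism is extremal if in each of its factorizations `π ≫ f` with `π` an epimorphism,
`π` is an isomorphism. (The dual notion is Mathlib's `CategoryTheory.ExtremalEpi`.) -/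
class ExtremalMono {X Y : C} (i : X ⟶ Y) : Prop extends Mono i where
  isIso {Z : C} (π : X ⟶ Z) (f : Z ⟶ Y) (fac : π ≫ f = i) [Epi π] : IsIso π

variable (C)

/-- (Epi, ExtrMono)-structured categories. -/
structure IsEpiExtremalMonoStructured : Prop where
  factorization {X Y : C} (f : X ⟶ Y) :
    ∃ (Z : C) (π : X ⟶ Z) (i : Z ⟶ Y), Epi π ∧ ExtremalMono i ∧ π ≫ i = f
  diagonal {P Q A B : C} (π : P ⟶ Q) (i : A ⟶ B) [Epi π] [ExtremalMono i] : HasLiftingProperty π i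

/-- (ExtrEpi, Mono)-structured categories. -/
structure IsExtremalEpiMonoStructured : Prop where
  factorization {X Y : C} (f : X ⟶ Y) :
    ∃ (Z : C) (π : X ⟶ Z) (i : Z ⟶ Y), ExtremalEpi π ∧ Mono i ∧ π ≫ i = f
  diagonal {P Q A B : C} (π : P ⟶ Q) (i : A ⟶ B) [ExtremalEpi π] [Mono i] : HasLiftingProperty π i

variable [MonoidalCategory C]

/-- The conditions on a monoidal base category. Small means: in the universe `v` of the morphisms.
The families of subobjects in `tensorLeft_intersections` may be indexed by types in any
universe `w`. -/
structure BaseConditions : Prop where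
  /-- there exist all small limits -/
  limits : HasLimits C
  /-- there exist finite and countable colimits -/
  finite_countable_colimits : HasFiniteColimits C ∧ HasCountableColimits C
  epi_extremalMono : IsEpiExtremalMonoStructured C
  wellpowered : WellPowered.{v} C
  cowellpowered : WellPowered.{v} Cᵒᵖ
  /-- tensoring with an object on either side preserves monomorphisms -/
  mono_tensor {X Y : C} (f : X ⟶ Y) (M : C) : Mono f → Mono (f ▷ M) ∧ Mono (M ◁ f)
  extremalMono_tensor {X Y : C} (f : X ⟶ Y) : ExtremalMono f → ExtremalMono (f ⊗ₘ f)
  /-- tensoring with an object on either side preserves epimorphisms -/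
  epi_tensor {X Y : C} (f : X ⟶ Y) (M : C) : Epi f → Epi (f ▷ M) ∧ Epi (M ◁ f)
  /-- `M ⊗ (-)` preserves intersections of families of extremal subobjects of an object `B` -/
  tensorLeft_intersections (M B : C) (Λ : Type w) (A : Λ → C) (φ : ∀ a, A a ⟶ B) :
    (∀ a, ExtremalMono (φ a)) →
      PreservesLimit (WidePullbackShape.wideCospan B A φ) (tensorLeft M)
  /-- `M ⊗ (-)` preserves preimages -/
  tensorLeft_preimages (M : C) {P A D B : C} (t : P ⟶ A) (h : P ⟶ D) (f : A ⟶ B) (g : D ⟶ B) :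
    Mono f → IsPullback t h f g → IsPullback (M ◁ t) (M ◁ h) (M ◁ f) (M ◁ g)
  /-- the comparison morphism `M ⊗ ∏ A_a ⟶ ∏ (M ⊗ A_a)` is a monomorphism -/
  tensorLeft_products (Λ : Type v) [Nonempty Λ] (M : C) (A : Λ → C)
    [HasProduct A] [HasProduct fun a => M ⊗ A a] :
    Mono (Pi.lift fun a => M ◁ Pi.π A a)
  /-- `M ⊗ (-)` preserves all equalizers -/
  tensorLeft_equalizers (M : C) {X Y : C} (f g : X ⟶ Y) :
    PreservesLimit (parallelPair f g) (tensorLeft M)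
  /-- the forgetful functor from monoids has a left adjoint -/
  free_monoid : (Mon.forget C).IsRightAdjoint

/-- The dual conditions on a monoidal base category. Small means: in the universe `v` of the
morphisms. The families of quotient objects in `tensorRight_cointersections` may be indexed by
types in any universe `w`. -/
structure DualBaseConditions : Prop where
  /-- there exist all small colimits -/
  colimits : HasColimits C
  /-- there exist finite and countable limits -/
  finite_countable_limits : HasFiniteLimits C ∧ HasCountableLimits C
  extremalEpi_mono : IsExtremalEpiMonoStructured C
  wellpowered : WellPowered.{v} C
  cowellpowered : WellPowered.{v} Cᵒᵖ
  /-- tensoring with an object on either side preserves monomorphisms -/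
  mono_tensor {X Y : C} (f : X ⟶ Y) (M : C) : Mono f → Mono (f ▷ M) ∧ Mono (M ◁ f)
  /-- tensoring with an object on either side preserves epimorphisms -/
  epi_tensor {X Y : C} (f : X ⟶ Y) (M : C) : Epi f → Epi (f ▷ M) ∧ Epi (M ◁ f)
  extremalEpi_tensor {X Y : C} (f : X ⟶ Y) : ExtremalEpi f → ExtremalEpi (f ⊗ₘ f)
  /-- `(-) ⊗ M` preserves colimits of families of extremal quotient objects of an object `A` -/
  tensorRight_cointersections (M A : C) (Λ : Type w) (B : Λ → C) (φ : ∀ a, A ⟶ B a) :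
    (∀ a, ExtremalEpi (φ a)) →
      PreservesColimit (WidePushoutShape.wideSpan A B φ) (tensorRight M)
  /-- `(-) ⊗ M` preserves pushouts of epimorphisms -/
  tensorRight_pushouts (M : C) {A D B P : C} (g : A ⟶ D) (f : A ⟶ B) (h : D ⟶ P) (t : B ⟶ P) :
    Epi f → IsPushout g f h t → IsPushout (g ▷ M) (f ▷ M) (h ▷ M) (t ▷ M)
  /-- the comparison morphism `∐ (A_a ⊗ M) ⟶ (∐ A_a) ⊗ M` is an epimorphism -/
  tensorRight_coproducts (Λ : Type v) [Nonempty Λ] (M : C) (A : Λ → C)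
    [HasCoproduct A] [HasCoproduct fun a => A a ⊗ M] :
    Epi (Sigma.desc fun a => Sigma.ι A a ▷ M)
  /-- `(-) ⊗ M` preserves all coequalizers -/
  tensorRight_coequalizers (M : C) {X Y : C} (f g : X ⟶ Y) :
    PreservesColimit (parallelPair f g) (tensorRight M)
  /-- the forgetful functor from comonoids has a right adjoint -/
  cofree_comonoid : (Comon.forget C).IsLeftAdjoint

end Properties

/-! The category is abelian, hence balanced, and images give the factorizations; so every mono and
every epi is extremal. What remains concerns the tensor product and the two adjoints.

Over a field, choose a basis of each `M_p`. Then `(M ⊗ V)_n` is a direct sum of copies of the spaces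
`V_{n-p}`, one for each basis vector, and `M ◁ f` acts on each copy by `f`
(`tensorCoord_whiskerLeft`). This decomposition ignores the differential, but exactness,
intersections of subobjects and joint injectivity or surjectivity of a family are decided degree by
degree. Disks and codisks translate universal properties of complexes into statements about elements
of, and linear maps out of, a single degree. The Koszul braiding carries the results for `M ⊗ -`
over to `- ⊗ M`.

Free monoids come from the general adjoint functor theorem. The submonoid generated by `X ⟶ A` is
the image of the coproduct `T` of the tensor powers of `X`, hence a quotient of an object
independent of `A` (`Mon.exists_submonoid`). The argument needs only that the inclusions into `T`
stay jointly epic after tensoring, not that tensoring preserves the coproduct. In this form it also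
applies to the opposite category, where `T` is a product and the condition becomes injectivity of `M
⊗ ∏ A_n ⟶ ∏ (M ⊗ A_n)`; this yields cofree comonoids. -/

namespace CategoryTheory.GradedObject.Monoidal

/-! ### The Koszul braiding of graded objects -/

open Category

variable {C : Type*} [Category* C] [MonoidalCategory C] [Preadditive C]

section

variable [BraidedCategory C]

/-- The Koszul braiding `u ⊗ v ↦ (-1)^{pq} v ⊗ u` of `ℤ`-graded objects. -/
noncomputable def koszulHom (X Y : GradedObject ℤ C) [HasTensor X Y] [HasTensor Y X] :
    tensorObj X Y ⟶ tensorObj Y X :=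
  fun k => tensorObjDesc (fun i j hij => (i * j).negOnePow • ((β_ _ _).hom ≫
    ιTensorObj Y X j i k (by simpa only [add_comm j i] using hij)))

@[simp]
lemma ι_koszulHom (X Y : GradedObject ℤ C) [HasTensor X Y] [HasTensor Y X]
    (i j k : ℤ) (h : i + j = k) :
    ιTensorObj X Y i j k h ≫ koszulHom X Y k =
      (i * j).negOnePow • ((β_ _ _).hom ≫
        ιTensorObj Y X j i k (by simpa only [add_comm j i] using h)) := by
  simp [koszulHom]

@[simp]
lemma ι_koszulHom_assoc (X Y : GradedObject ℤ C) [HasTensor X Y] [HasTensor Y X]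
    (i j k : ℤ) (h : i + j = k) {A : C} (f : tensorObj Y X k ⟶ A) :
    ιTensorObj X Y i j k h ≫ koszulHom X Y k ≫ f =
      (i * j).negOnePow • ((β_ _ _).hom ≫
        ιTensorObj Y X j i k (by simpa only [add_comm j i] using h) ≫ f) := by
  simp [← Category.assoc]

end

@[simp]
lemma koszulHom_symmetry [SymmetricCategory C] (X Y : GradedObject ℤ C)
    [HasTensor X Y] [HasTensor Y X] :
    koszulHom X Y ≫ koszulHom Y X = 𝟙 _ := by
  ext k i j h
  simp [smul_smul, mul_comm j i]

section

variable [MonoidalPreadditive C]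

lemma units_smul_whiskerRight {X Y : C} (a : ℤˣ) (f : X ⟶ Y) (Z : C) :
    (a • f) ▷ Z = a • (f ▷ Z) := by
  obtain rfl | rfl := Int.units_eq_one_or a
  · simp
  · rw [Units.neg_smul, Units.neg_smul, one_smul, one_smul]
    exact ((tensoringRight C).obj Z).map_neg

lemma whiskerLeft_units_smul {X Y : C} (a : ℤˣ) (f : X ⟶ Y) (Z : C) :
    Z ◁ (a • f) = a • (Z ◁ f) := by
  obtain rfl | rfl := Int.units_eq_one_or a
  · simp
  · rw [Units.neg_smul, Units.neg_smul, one_smul, one_smul]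
    exact ((tensoringLeft C).obj Z).map_neg

variable [BraidedCategory C] (X Y Z : GradedObject ℤ C)

/-- On each summand this is the hexagon of `C` together with the sign identity `(-1)^{i₁(i₂+i₃)} =
(-1)^{i₁i₂} (-1)^{i₁i₃}`. -/
lemma koszul_hexagon_forward [HasTensor X Y] [HasTensor Y X] [HasTensor Y Z]
    [HasTensor Z X] [HasTensor X Z]
    [HasTensor (tensorObj X Y) Z] [HasTensor X (tensorObj Y Z)]
    [HasTensor (tensorObj Y Z) X] [HasTensor Y (tensorObj Z X)]
    [HasTensor (tensorObj Y X) Z] [HasTensor Y (tensorObj X Z)]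
    [HasGoodTensor₁₂Tensor X Y Z] [HasGoodTensorTensor₂₃ X Y Z]
    [HasGoodTensor₁₂Tensor Y Z X] [HasGoodTensorTensor₂₃ Y Z X]
    [HasGoodTensor₁₂Tensor Y X Z] [HasGoodTensorTensor₂₃ Y X Z] :
    (associator X Y Z).hom ≫ koszulHom X (tensorObj Y Z) ≫ (associator Y Z X).hom =
      whiskerRight (koszulHom X Y) Z ≫ (associator Y X Z).hom ≫
        whiskerLeft Y (koszulHom X Z) := by
  ext k i₁ i₂ i₃ h
  dsimp
  conv_lhs => rw [ιTensorObj₃'_associator_hom_assoc, ιTensorObj₃_eq X Y Z i₁ i₂ i₃ k h _ rfl,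
    assoc, ι_koszulHom_assoc, Linear.comp_units_smul,
    ← MonoidalCategory.id_tensorHom,
    BraidedCategory.braiding_naturality_assoc,
    BraidedCategory.braiding_tensor_right_hom, assoc, assoc, assoc, assoc,
    Linear.comp_units_smul, Iso.hom_inv_id_assoc,
    MonoidalCategory.tensorHom_id,
    ← ιTensorObj₃'_eq_assoc Y Z X i₂ i₃ i₁ k (by rw [add_comm _ i₁, ← add_assoc, h]) _ rfl,
    ιTensorObj₃'_associator_hom, Iso.inv_hom_id_assoc]
  conv_rhs => rw [ιTensorObj₃'_eq X Y Z i₁ i₂ i₃ k h _ rfl, assoc, ι_tensorHom_assoc,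
    ← MonoidalCategory.tensorHom_id,
    MonoidalCategory.tensorHom_comp_tensorHom_assoc, id_comp, ι_koszulHom,
    categoryOfGradedObjects_id, MonoidalCategory.tensorHom_id, units_smul_whiskerRight,
    MonoidalCategory.comp_whiskerRight, Linear.units_smul_comp, assoc,
    ← ιTensorObj₃'_eq_assoc Y X Z i₂ i₁ i₃ k
      (by rw [add_comm i₂ i₁, h]) (i₁ + i₂) (add_comm i₂ i₁),
    ιTensorObj₃'_associator_hom_assoc,
    ιTensorObj₃_eq Y X Z i₂ i₁ i₃ k (by rw [add_comm i₂ i₁, h]) _ rfl, assoc,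
    ι_tensorHom, categoryOfGradedObjects_id,
    MonoidalCategory.id_tensorHom,
    ← MonoidalCategory.whiskerLeft_comp_assoc,
    ι_koszulHom, whiskerLeft_units_smul, MonoidalCategory.whiskerLeft_comp,
    Linear.units_smul_comp, assoc, Linear.comp_units_smul, Linear.comp_units_smul, smul_smul,
    ← ιTensorObj₃_eq Y Z X i₂ i₃ i₁ k (by rw [add_comm _ i₁, ← add_assoc, h])
      (i₁ + i₃) (add_comm _ _), ← Int.negOnePow_add, ← mul_add]

lemma koszul_hexagon_reverse [HasTensor X Y] [HasTensor Y Z] [HasTensor Z X]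
    [HasTensor Z Y] [HasTensor X Z]
    [HasTensor (tensorObj X Y) Z] [HasTensor X (tensorObj Y Z)]
    [HasTensor Z (tensorObj X Y)] [HasTensor (tensorObj Z X) Y]
    [HasTensor X (tensorObj Z Y)] [HasTensor (tensorObj X Z) Y]
    [HasGoodTensor₁₂Tensor X Y Z] [HasGoodTensorTensor₂₃ X Y Z]
    [HasGoodTensor₁₂Tensor Z X Y] [HasGoodTensorTensor₂₃ Z X Y]
    [HasGoodTensor₁₂Tensor X Z Y] [HasGoodTensorTensor₂₃ X Z Y] :
    (associator X Y Z).inv ≫ koszulHom (tensorObj X Y) Z ≫ (associator Z X Y).inv =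
      whiskerLeft X (koszulHom Y Z) ≫ (associator X Z Y).inv ≫
        whiskerRight (koszulHom X Z) Y := by
  ext k i₁ i₂ i₃ h
  dsimp
  conv_lhs => rw [ιTensorObj₃_associator_inv_assoc, ιTensorObj₃'_eq X Y Z i₁ i₂ i₃ k h _ rfl, assoc,
    ι_koszulHom_assoc, Linear.comp_units_smul,
    ← MonoidalCategory.tensorHom_id,
    BraidedCategory.braiding_naturality_assoc,
    BraidedCategory.braiding_tensor_left_hom, assoc, assoc, assoc, assoc,
    Linear.comp_units_smul, Iso.inv_hom_id_assoc,
    MonoidalCategory.id_tensorHom,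
    ← ιTensorObj₃_eq_assoc Z X Y i₃ i₁ i₂ k (by rw [add_assoc, add_comm i₃, h]) _ rfl,
    ιTensorObj₃_associator_inv, Iso.hom_inv_id_assoc]
  conv_rhs => rw [ιTensorObj₃_eq X Y Z i₁ i₂ i₃ k h _ rfl, assoc, ι_tensorHom_assoc,
    ← MonoidalCategory.id_tensorHom,
    MonoidalCategory.tensorHom_comp_tensorHom_assoc, id_comp, ι_koszulHom,
    categoryOfGradedObjects_id, MonoidalCategory.id_tensorHom, whiskerLeft_units_smul,
    MonoidalCategory.whiskerLeft_comp, Linear.units_smul_comp, assoc,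
    ← ιTensorObj₃_eq_assoc X Z Y i₁ i₃ i₂ k
      (by rw [add_assoc, add_comm i₃, ← add_assoc, h]) (i₂ + i₃) (add_comm _ _),
    ιTensorObj₃_associator_inv_assoc,
    ιTensorObj₃'_eq X Z Y i₁ i₃ i₂ k (by rw [add_assoc, add_comm i₃, ← add_assoc, h]) _ rfl,
    assoc, ι_tensorHom, categoryOfGradedObjects_id, MonoidalCategory.tensorHom_id,
    ← MonoidalCategory.comp_whiskerRight_assoc,
    ι_koszulHom, units_smul_whiskerRight, MonoidalCategory.comp_whiskerRight,
    Linear.units_smul_comp, assoc, Linear.comp_units_smul, Linear.comp_units_smul, smul_smul,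
    ← ιTensorObj₃'_eq Z X Y i₃ i₁ i₂ k (by rw [add_assoc, add_comm i₃, h])
      (i₁ + i₃) (add_comm _ _), ← Int.negOnePow_add, add_comm (i₂ * i₃), ← add_mul]

end

end CategoryTheory.GradedObject.Monoidal

/-! ### The Koszul braiding of complexes -/

namespace DgVect

open HomologicalComplex TensorProduct

variable {k : Type u} [Field k]

@[simp]
lemma ι_whiskerLeft (M : DgVect k) {V W : DgVect k} (f : V ⟶ W) (p q n : ℤ) (h : p + q = n) :
    ιTensorObj M V p q n h ≫ (M ◁ f).f n = M.X p ◁ f.f q ≫ ιTensorObj M W p q n h := by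
  refine (ι_mapBifunctorMap (𝟙 M) f (curriedTensor _) _ p q n h).trans ?_
  simp

@[simp]
lemma ι_whiskerLeft_assoc (M : DgVect k) {V W : DgVect k} (f : V ⟶ W) (p q n : ℤ)
    (h : p + q = n) {A : ModuleCat.{u} k} (g : (M ⊗ W).X n ⟶ A) :
    ιTensorObj M V p q n h ≫ (M ◁ f).f n ≫ g = M.X p ◁ f.f q ≫ ιTensorObj M W p q n h ≫ g := by
  rw [← Category.assoc, ι_whiskerLeft, Category.assoc]

@[simp]
lemma ι_whiskerRight (M : DgVect k) {V W : DgVect k} (f : V ⟶ W) (p q n : ℤ) (h : p + q = n) :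
    ιTensorObj V M p q n h ≫ (f ▷ M).f n = f.f p ▷ M.X q ≫ ιTensorObj W M p q n h := by
  refine (ι_mapBifunctorMap f (𝟙 M) (curriedTensor _) _ p q n h).trans ?_
  simp

@[simp]
lemma ι_whiskerRight_assoc (M : DgVect k) {V W : DgVect k} (f : V ⟶ W) (p q n : ℤ)
    (h : p + q = n) {A : ModuleCat.{u} k} (g : (W ⊗ M).X n ⟶ A) :
    ιTensorObj V M p q n h ≫ (f ▷ M).f n ≫ g = f.f p ▷ M.X q ≫ ιTensorObj W M p q n h ≫ g := by
  rw [← Category.assoc, ι_whiskerRight, Category.assoc]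

lemma ι_d (U V : DgVect k) (p q p' q' n n' : ℤ) (h : p + q = n) (hn : n' + 1 = n)
    (hp : p' + 1 = p) (hq : q' + 1 = q) :
    ιTensorObj U V p q n h ≫ (U ⊗ V).d n n' =
      U.d p p' ▷ V.X q ≫ ιTensorObj U V p' q n' (by omega) +
      p.negOnePow • (U.X p ◁ V.d q q' ≫ ιTensorObj U V p q' n' (by omega)) := by
  change ιMapBifunctor _ _ _ _ _ _ _ _ ≫ (mapBifunctor _ _ _ _).d _ _ = _
  rw [mapBifunctor.d_eq, Preadditive.comp_add, mapBifunctor.ι_D₁, mapBifunctor.ι_D₂,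
    mapBifunctor.d₁_eq _ _ _ _ (show (ComplexShape.down ℤ).Rel p p' from hp) _ _ (by simp; omega),
    mapBifunctor.d₂_eq _ _ _ _ _ (show (ComplexShape.down ℤ).Rel q q' from hq) _ (by simp; omega)]
  simp
  rfl

@[ext]
lemma tensor_hom_ext {U V : DgVect k} {n : ℤ} {A : ModuleCat.{u} k} {f g : (U ⊗ V).X n ⟶ A}
    (h : ∀ (p q : ℤ) (hpq : p + q = n),
      ιTensorObj U V p q n hpq ≫ f = ιTensorObj U V p q n hpq ≫ g) : f = g :=
  mapBifunctor.hom_ext h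

/-- The component in degree `n` of the Koszul braiding. -/
noncomputable def koszulX (U V : DgVect k) (n : ℤ) : (U ⊗ V).X n ⟶ (V ⊗ U).X n :=
  GradedObject.Monoidal.koszulHom U.X V.X n

lemma ι_koszulX (U V : DgVect k) (p q n : ℤ) (h : p + q = n) :
    ιTensorObj U V p q n h ≫ koszulX U V n =
      (p * q).negOnePow • ((β_ (U.X p) (V.X q)).hom ≫
        ιTensorObj V U q p n ((add_comm q p).trans h)) :=
  GradedObject.Monoidal.ι_koszulHom U.X V.X p q n h

/-- The Koszul braiding of differential graded vector spaces. -/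
noncomputable def koszulHom (U V : DgVect k) : U ⊗ V ⟶ V ⊗ U where
  f n := koszulX U V n
  comm' n n' h := by
    ext p q hpq : 1
    have hn : n' + 1 = n := h
    rw [← Category.assoc, ← Category.assoc, ι_koszulX,
      ι_d U V p q (p - 1) (q - 1) n n' hpq hn (by omega) (by omega),
      Linear.units_smul_comp, Category.assoc,
      ι_d V U q p (q - 1) (p - 1) n n' (by omega) hn (by omega) (by omega),
      Preadditive.add_comp, Linear.units_smul_comp, Category.assoc, Category.assoc,
      ι_koszulX, ι_koszulX, Linear.comp_units_smul, Linear.comp_units_smul, Preadditive.comp_add,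
      BraidedCategory.braiding_naturality_left_assoc,
      BraidedCategory.braiding_naturality_right_assoc, Linear.comp_units_smul,
      smul_add, smul_smul, smul_smul, add_comm, ← Int.negOnePow_add, ← Int.negOnePow_add]
    -- The signs to compare are those of `v ⊗ du`, with exponents `pq + q` and `(p - 1)q` differing
    -- by `2q`, and those of `dv ⊗ u`, with exponents `pq` and `p + p(q - 1)`, which are equal.
    congr 2
    · rw [Int.negOnePow_eq_iff]
      exact ⟨q, by ring⟩
    · rw [Int.negOnePow_eq_iff]
      exact ⟨0, by ring⟩

@[simp]
lemma ι_koszulHom (U V : DgVect k) (p q n : ℤ) (h : p + q = n) :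
    ιTensorObj U V p q n h ≫ (koszulHom U V).f n =
      (p * q).negOnePow • ((β_ (U.X p) (V.X q)).hom ≫
        ιTensorObj V U q p n ((add_comm q p).trans h)) :=
  ι_koszulX U V p q n h

@[simp]
lemma ι_koszulHom_assoc (U V : DgVect k) (p q n : ℤ) (h : p + q = n) {A : ModuleCat.{u} k}
    (f : (V ⊗ U).X n ⟶ A) :
    ιTensorObj U V p q n h ≫ (koszulHom U V).f n ≫ f =
      (p * q).negOnePow • ((β_ (U.X p) (V.X q)).hom ≫
        ιTensorObj V U q p n ((add_comm q p).trans h) ≫ f) := by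
  rw [← Category.assoc, ι_koszulHom, Linear.units_smul_comp, Category.assoc]

/-- The Koszul braiding as an isomorphism. -/
@[simps]
noncomputable def koszulIso (U V : DgVect k) : U ⊗ V ≅ V ⊗ U where
  hom := koszulHom U V
  inv := koszulHom V U
  hom_inv_id := by
    ext n : 1
    exact congr_fun (GradedObject.Monoidal.koszulHom_symmetry U.X V.X) n
  inv_hom_id := by
    ext n : 1
    exact congr_fun (GradedObject.Monoidal.koszulHom_symmetry V.X U.X) n

/-- The symmetric monoidal structure on differential graded vector spaces. -/
@[reducible]
noncomputable def symmetricCategory : SymmetricCategory (DgVect k) where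
  braiding U V := koszulIso U V
  braiding_naturality_right M V W f := by ext n p q h : 2; simp
  braiding_naturality_left f M := by ext n p q h : 2; simp
  -- The hexagons do not involve the differential: in each degree they are those of the underlying
  -- graded objects.
  hexagon_forward U V W := by
    ext n : 1
    exact congr_fun (GradedObject.Monoidal.koszul_hexagon_forward U.X V.X W.X) n
  hexagon_reverse U V W := by
    ext n : 1
    exact congr_fun (GradedObject.Monoidal.koszul_hexagon_reverse U.X V.X W.X) n
  symmetry U V := (koszulIso U V).hom_inv_id

/-! ### Coordinates on `M ⊗ V` from bases of the `M_p` -/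

section Coordinates

variable (M V : DgVect k) (n : ℤ)

/-- The indices of the coordinates in degree `n` of a tensor product with `M`: pairs of degrees
with sum `n` and a basis vector of `M` in the first of them. -/
abbrev CoordIndex : Type u :=
  Σ x : {x : ℤ × ℤ // x.1 + x.2 = n}, Module.Basis.ofVectorSpaceIndex k (M.X x.1.1)

variable {M n} in
/-- The inclusion `v ↦ b ⊗ v` of a summand for a basis vector `b` of `M`. -/
noncomputable def basisTensor (i : CoordIndex M n) : V.X i.1.1.2 →ₗ[k] (M ⊗ V).X n :=
  (ιTensorObj M V _ _ n i.1.2).hom ∘ₗ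
    TensorProduct.mk k _ _ (Module.Basis.ofVectorSpace k (M.X i.1.1.1) i.2)

variable {M V n} in
lemma tensor_linearMap_ext {N : Type*} [AddCommGroup N] [Module k N]
    {f g : (M ⊗ V).X n →ₗ[k] N}
    (h : ∀ i : CoordIndex M n, f ∘ₗ basisTensor V i = g ∘ₗ basisTensor V i) : f = g := by
  suffices ∀ (p q : ℤ) (hpq : p + q = n) (x : M.X p ⊗[k] V.X q),
      f ((ιTensorObj M V p q n hpq).hom x) = g ((ιTensorObj M V p q n hpq).hom x) by
    rw [← sub_eq_zero]
    have e : ∀ x, x ∈ LinearMap.ker (f - g) := by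
      -- `N` may live in any universe, while `tensor_hom_ext` tests maps into `ModuleCat.{u} k`. The
      -- quotient by `ker (f - g)` is such a target, and its projection vanishes exactly when `f =
      -- g`.
      have : ModuleCat.ofHom (LinearMap.ker (f - g)).mkQ = 0 := by
        refine tensor_hom_ext fun p q hpq => ?_
        ext : 1
        refine LinearMap.ext fun x => ?_
        simp only [ModuleCat.hom_comp, ModuleCat.hom_ofHom, LinearMap.comp_apply, comp_zero,
          ModuleCat.hom_zero, LinearMap.zero_apply]
        rw [Submodule.mkQ_apply, Submodule.Quotient.mk_eq_zero, LinearMap.mem_ker,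
          LinearMap.sub_apply, this, sub_self]
      intro x
      rw [← Submodule.Quotient.mk_eq_zero]
      exact congr($(this).hom x)
    exact LinearMap.ext e
  intro p q hpq
  suffices f ∘ₗ (ιTensorObj M V p q n hpq).hom = g ∘ₗ (ιTensorObj M V p q n hpq).hom from
    fun x => congr($this x)
  refine TensorProduct.ext ?_
  refine (Module.Basis.ofVectorSpace k (M.X p)).ext fun b => ?_
  exact h ⟨⟨(p, q), hpq⟩, b⟩

open scoped Classical in
/-- The coordinates of an element of `M ⊗ V` with respect to a basis of `M`. -/
noncomputable def tensorCoord :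
    (M ⊗ V).X n →ₗ[k] Π₀ i : CoordIndex M n, V.X i.1.1.2 :=
  (mapBifunctorDesc (A := ModuleCat.of k (Π₀ i : CoordIndex M n, V.X i.1.1.2))
    (K₁ := M) (K₂ := V) (F := curriedTensor (ModuleCat.{u} k)) (fun p q h =>
      ModuleCat.ofHom (TensorProduct.lift ((Module.Basis.ofVectorSpace k (M.X p)).constr k
      (fun b => DFinsupp.lsingle (M := fun i : CoordIndex M n => V.X i.1.1.2)
        (⟨⟨(p, q), h⟩, b⟩ : CoordIndex M n)))))).hom

open scoped Classical in
@[simp]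
lemma tensorCoord_basisTensor (i : CoordIndex M n) (v : V.X i.1.1.2) :
    tensorCoord M V n (basisTensor V i v) = DFinsupp.single i v := by
  have := ι_mapBifunctorDesc (A := ModuleCat.of k (Π₀ i : CoordIndex M n, V.X i.1.1.2))
    (K₁ := M) (K₂ := V) (F := curriedTensor (ModuleCat.{u} k)) (c := ComplexShape.down ℤ)
    (fun p q h =>
      ModuleCat.ofHom (TensorProduct.lift ((Module.Basis.ofVectorSpace k (M.X p)).constr k
      (fun b => DFinsupp.lsingle (M := fun i : CoordIndex M n => V.X i.1.1.2)
        (⟨⟨(p, q), h⟩, b⟩ : CoordIndex M n))))) i.1.1.1 i.1.1.2 i.1.2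
  refine (congr($(this).hom (Module.Basis.ofVectorSpace k (M.X i.1.1.1) i.2 ⊗ₜ v))).trans ?_
  simp only [ModuleCat.hom_ofHom, TensorProduct.lift.tmul]
  rw [Module.Basis.constr_basis]
  rfl

variable {M V n}

open scoped Classical in
lemma basisTensor_sum_tensorCoord (y : (M ⊗ V).X n) :
    DFinsupp.lsum ℕ (fun i => basisTensor V i) (tensorCoord M V n y) = y := by
  have : DFinsupp.lsum k (fun i => basisTensor V i) ∘ₗ tensorCoord M V n = LinearMap.id := by
    refine tensor_linearMap_ext fun i => LinearMap.ext fun v => ?_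
    simp
  exact congr($this y)

/-- `y` is the finite sum of its components `b ⊗ y_b`. Questions about `M ⊗ V` are thereby reduced
to `V`, one coordinate at a time. -/
lemma mem_of_tensorCoord (S : Submodule k ((M ⊗ V).X n)) (y : (M ⊗ V).X n)
    (h : ∀ i, basisTensor V i (tensorCoord M V n y i) ∈ S) : y ∈ S := by
  classical
  rw [← basisTensor_sum_tensorCoord y]
  exact dfinsuppSumAddHom_mem S _ _ fun i _ => h i

lemma eq_zero_of_tensorCoord (y : (M ⊗ V).X n) (h : ∀ i, tensorCoord M V n y i = 0) : y = 0 := by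
  simpa using mem_of_tensorCoord ⊥ y (by simp [h])

variable {W : DgVect k} (f : V ⟶ W)

@[simp]
lemma whiskerLeft_basisTensor (i : CoordIndex M n) (v : V.X i.1.1.2) :
    ((M ◁ f).f n).hom (basisTensor V i v) = basisTensor W i ((f.f _).hom v) :=
  congr($(ι_whiskerLeft M f _ _ n i.1.2).hom (Module.Basis.ofVectorSpace k (M.X i.1.1.1) i.2 ⊗ₜ v))

@[simp]
lemma tensorCoord_whiskerLeft (y : (M ⊗ V).X n) (i : CoordIndex M n) :
    tensorCoord M W n (((M ◁ f).f n).hom y) i = (f.f _).hom (tensorCoord M V n y i) := by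
  classical
  have : DFinsupp.lapply i ∘ₗ tensorCoord M W n ∘ₗ ((M ◁ f).f n).hom =
      (f.f _).hom ∘ₗ DFinsupp.lapply i ∘ₗ tensorCoord M V n := by
    refine tensor_linearMap_ext fun j => LinearMap.ext fun v => ?_
    simp only [LinearMap.comp_apply, DFinsupp.lapply_apply, whiskerLeft_basisTensor,
      tensorCoord_basisTensor]
    by_cases h : j = i
    · subst h; simp
    · rw [DFinsupp.single_eq_of_ne (Ne.symm h), DFinsupp.single_eq_of_ne (Ne.symm h), map_zero]
  exact congr($this y)

end Coordinates

/-! ### Exactness of the tensor product -/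

instance tensorLeft_additive (M : DgVect k) : (tensorLeft M).Additive where
  map_add {V W f g} := by
    ext n : 1
    refine tensor_hom_ext fun p q h => ?_
    simp [MonoidalPreadditive.whiskerLeft_add]

/-- The coordinates of a kernel element lie in the kernel of `S.g`, so each has a preimage `x` under
`S.f`; then `b ⊗ x` is a preimage of the corresponding component. -/
lemma tensorLeft_map_exact (M : DgVect k) (S : ShortComplex (DgVect k)) (hS : S.Exact) :
    (S.map (tensorLeft M)).Exact := by
  rw [exact_iff_degreewise_exact] at hS ⊢
  intro n
  rw [ShortComplex.moduleCat_exact_iff_ker_sub_range]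
  intro y hy
  refine mem_of_tensorCoord (M := M) (V := S.X₂) _ y fun i => ?_
  have h := (ShortComplex.moduleCat_exact_iff _).1 (hS i.1.1.2) (tensorCoord M S.X₂ n y i)
  obtain ⟨x, hx⟩ := h (by
    refine (tensorCoord_whiskerLeft S.g y i).symm.trans ?_
    have : ((M ◁ S.g).f n).hom y = 0 := hy
    rw [this, map_zero]
    rfl)
  refine ⟨basisTensor S.X₁ i x, ?_⟩
  refine (whiskerLeft_basisTensor S.f i x).trans ?_
  exact congrArg _ hx

instance tensorLeft_preservesFiniteLimits (M : DgVect k) :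
    PreservesFiniteLimits (tensorLeft M) := by
  have := Functor.preservesHomology_of_map_exact (tensorLeft M) (tensorLeft_map_exact M)
  exact Functor.preservesFiniteLimits_of_preservesHomology _

instance tensorLeft_preservesFiniteColimits (M : DgVect k) :
    PreservesFiniteColimits (tensorLeft M) := by
  have := Functor.preservesHomology_of_map_exact (tensorLeft M) (tensorLeft_map_exact M)
  exact Functor.preservesFiniteColimits_of_preservesHomology _

/-- Tensoring on the left and on the right agree up to the Koszul braiding. -/
noncomputable def tensorLeftIsoTensorRight (M : DgVect k) : tensorLeft M ≅ tensorRight M :=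
  letI := symmetricCategory (k := k)
  BraidedCategory.tensorLeftIsoTensorRight M

instance tensorRight_preservesFiniteLimits (M : DgVect k) :
    PreservesFiniteLimits (tensorRight M) :=
  preservesFiniteLimits_of_natIso (tensorLeftIsoTensorRight M)

instance tensorRight_preservesFiniteColimits (M : DgVect k) :
    PreservesFiniteColimits (tensorRight M) :=
  preservesFiniteColimits_of_natIso (tensorLeftIsoTensorRight M)

/-! ### Disks and codisks -/

/-- The elements of degree `q` of a complex are the morphisms from a disk. -/
lemma exists_disk (k : Type u) [Field k] (q : ℤ) :
    ∃ (D : DgVect k) (e : ∀ K : DgVect k, (D ⟶ K) ≃ K.X q),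
      ∀ {K L : DgVect k} (f : D ⟶ K) (g : K ⟶ L), e L (f ≫ g) = (g.f q).hom (e K f) := by
  have h : (ComplexShape.down ℤ).Rel q (q - 1) := by simp
  let E := evalCompCoyonedaCorepresentableByDoubleId h (by omega) (ModuleCat.of k k)
  refine ⟨_, fun K => E.homEquiv.trans
    (ModuleCat.homEquiv.trans (LinearMap.ringLmapEquivSelf k k (K.X q)).toEquiv), ?_⟩
  intro K L f g
  simp only [Equiv.trans_apply, E.homEquiv_comp]
  rfl

/-- Linear maps from the degree `q` part of a complex are the morphisms to a codisk. -/
lemma exists_codisk (V : ModuleCat.{u} k) (q : ℤ) :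
    ∃ (D : DgVect k) (e : ∀ K : DgVect k, (K ⟶ D) ≃ (K.X q ⟶ V)),
      ∀ {K L : DgVect k} (f : K ⟶ L) (g : L ⟶ D), e K (f ≫ g) = f.f q ≫ e L g := by
  have h : (ComplexShape.down ℤ).Rel (q + 1) q := by simp
  have hne : q + 1 ≠ q := by omega
  let D := double (𝟙 V) h
  let i₀ : D.X (q + 1) ≅ V := doubleXIso₀ _ h
  let i₁ : D.X q ≅ V := doubleXIso₁ _ h hne
  have hd : D.d (q + 1) q = i₀.hom ≫ i₁.inv := by
    simp [D, i₀, i₁, double_d (𝟙 V) h hne]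
  -- The codisk is `V = V` in degrees `q + 1` and `q`. The component in degree `q + 1` is forced to
  -- be `d` followed by `φ`, and compatibility one degree higher is `d² = 0`.
  have key (K : DgVect k) (φ : K.X q ⟶ V) : ∃ F : K ⟶ D, F.f q ≫ i₁.hom = φ := by
    refine ⟨{ f := fun j => if h₁ : j = q then eqToHom (by rw [h₁]) ≫ φ ≫ i₁.inv ≫
                  eqToHom (by rw [h₁]) else if h₀ : j = q + 1 then
                  eqToHom (by rw [h₀]) ≫ K.d (q + 1) q ≫ φ ≫ i₀.inv ≫ eqToHom (by rw [h₀]) else 0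
              comm' := ?_ }, ?_⟩
    · intro j j' hjj'
      obtain rfl : j' + 1 = j := hjj'
      by_cases h₁ : j' = q
      · subst h₁
        simp [hd]
      · by_cases h₀ : j' = q + 1
        · subst h₀
          rw [double_d_eq_zero₁ _ _ _ _ h₁, comp_zero, dif_neg h₁, dif_pos rfl]
          simp
        · exact (isZero_double_X _ h j' h₀ h₁).eq_of_tgt _ _
    · simp
  refine ⟨D, fun K => Equiv.ofBijective (fun F => F.f q ≫ i₁.hom) ⟨?_, fun φ => key K φ⟩, ?_⟩
  · intro F G hFG
    have hq : F.f q = G.f q := by simpa using hFG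
    refine to_double_hom_ext ?_ hq
    have hF := F.comm (q + 1) q
    have hG := G.comm (q + 1) q
    change F.f (q + 1) ≫ D.d (q + 1) q = _ at hF
    change G.f (q + 1) ≫ D.d (q + 1) q = _ at hG
    rw [hd, hq, ← hG, hd] at hF
    exact (cancel_mono (i₀.hom ≫ i₁.inv)).1 hF
  · intro K L f g
    exact Category.assoc (f.f q) (g.f q) i₁.hom

/-! ### Jointly monic and jointly epic families -/

section Families

variable {M P : DgVect k} {Λ : Type w} {A : Λ → DgVect k}

lemma eq_zero_of_jointlyMono (φ : ∀ a, P ⟶ A a)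
    (hφ : ∀ {T : DgVect k} (g h : T ⟶ P), (∀ a, g ≫ φ a = h ≫ φ a) → g = h) (q : ℤ) (x : P.X q)
    (hx : ∀ a, ((φ a).f q).hom x = 0) : x = 0 := by
  obtain ⟨D, e, he⟩ := exists_disk k q
  apply (e P).symm.injective
  refine hφ _ _ fun a => (e _).injective ?_
  simp [he, hx]

lemma eq_zero_of_jointlyEpi (φ : ∀ a, A a ⟶ P)
    (hφ : ∀ {T : DgVect k} (g h : P ⟶ T), (∀ a, φ a ≫ g = φ a ≫ h) → g = h) (q : ℤ)
    {V : ModuleCat.{u} k} (l : P.X q ⟶ V) (hl : ∀ a, (φ a).f q ≫ l = 0) : l = 0 := by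
  obtain ⟨D, e, he⟩ := exists_codisk V q
  apply (e P).symm.injective
  refine hφ _ _ fun a => (e _).injective ?_
  simp [he, hl]

/-- Every coordinate of an element killed by all `M ◁ φ a` is killed by all `φ a`, hence is zero.
Applied to the projections of a product, this gives the comparison monomorphism. -/
lemma tensorLeft_jointlyMono (φ : ∀ a, P ⟶ A a)
    (hφ : ∀ {T : DgVect k} (g h : T ⟶ P), (∀ a, g ≫ φ a = h ≫ φ a) → g = h)
    {T : DgVect k} (g h : T ⟶ M ⊗ P) (hgh : ∀ a, g ≫ M ◁ φ a = h ≫ M ◁ φ a) : g = h := by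
  rw [← sub_eq_zero]
  ext n t
  refine eq_zero_of_tensorCoord (M := M) (V := P) _ fun i => ?_
  refine eq_zero_of_jointlyMono φ hφ _ _ fun a => ?_
  rw [← tensorCoord_whiskerLeft]
  have : (g - h) ≫ M ◁ φ a = 0 := by rw [Preadditive.sub_comp, hgh, sub_self]
  have := congr(($this).f n t)
  refine (congrArg (fun z => tensorCoord M _ n z i) this).trans ?_
  simp

/-- On each copy `b ⊗ P_q` the difference `g - h` is a linear map on `P_q` that vanishes on the
images of all `φ a`, so the codisk criterion applies. -/
lemma tensorLeft_jointlyEpi (φ : ∀ a, A a ⟶ P)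
    (hφ : ∀ {T : DgVect k} (g h : P ⟶ T), (∀ a, φ a ≫ g = φ a ≫ h) → g = h)
    {T : DgVect k} (g h : M ⊗ P ⟶ T) (hgh : ∀ a, M ◁ φ a ≫ g = M ◁ φ a ≫ h) : g = h := by
  rw [← sub_eq_zero]
  ext n : 1
  refine ModuleCat.hom_ext (tensor_linearMap_ext (M := M) (V := P) fun i => ?_)
  suffices ModuleCat.ofHom (((g - h).f n).hom ∘ₗ basisTensor P i) = 0 from congr(($this).hom)
  refine eq_zero_of_jointlyEpi φ hφ i.1.1.2 _ fun a => ?_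
  have : M ◁ φ a ≫ (g - h) = 0 := by rw [Preadditive.comp_sub, hgh, sub_self]
  ext x
  refine Eq.trans ?_ congr(($this).f n (basisTensor (A a) i x))
  simp [← whiskerLeft_basisTensor]

lemma tensorRight_jointlyMono (φ : ∀ a, P ⟶ A a)
    (hφ : ∀ {T : DgVect k} (g h : T ⟶ P), (∀ a, g ≫ φ a = h ≫ φ a) → g = h)
    {T : DgVect k} (g h : T ⟶ P ⊗ M) (hgh : ∀ a, g ≫ φ a ▷ M = h ≫ φ a ▷ M) : g = h := by
  let := symmetricCategory (k := k)
  rw [← Iso.cancel_iso_hom_right _ _ (β_ P M)]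
  refine tensorLeft_jointlyMono φ hφ _ _ fun a => ?_
  simp only [Category.assoc, ← BraidedCategory.braiding_naturality_left, reassoc_of% hgh a]

lemma tensorRight_jointlyEpi (φ : ∀ a, A a ⟶ P)
    (hφ : ∀ {T : DgVect k} (g h : P ⟶ T), (∀ a, φ a ≫ g = φ a ≫ h) → g = h)
    {T : DgVect k} (g h : P ⊗ M ⟶ T) (hgh : ∀ a, φ a ▷ M ≫ g = φ a ▷ M ≫ h) : g = h := by
  let := symmetricCategory (k := k)
  rw [← Iso.cancel_iso_hom_left (β_ M P)]
  refine tensorLeft_jointlyEpi φ hφ _ _ fun a => ?_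
  simp only [BraidedCategory.braiding_naturality_right_assoc, hgh a]

end Families

lemma exists_lift_of_mono {X Y T : DgVect k} (f : X ⟶ Y) [Mono f] (g : T ⟶ Y)
    (h : ∀ n t, ∃ x, ((f.f n).hom x) = (g.f n).hom t) : ∃ l, l ≫ f = g := by
  refine ⟨Abelian.monoLift f g ?_, Abelian.monoLift_comp _ _ _⟩
  ext n t
  obtain ⟨x, hx⟩ := h n t
  have := congr(($(cokernel.condition f)).f n x)
  simp only [comp_f, ModuleCat.hom_comp, LinearMap.comp_apply, ← hx]
  exact this

lemma exists_desc_of_epi {X Y T : DgVect k} (f : X ⟶ Y) [Epi f] (g : X ⟶ T)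
    (h : ∀ n x, (f.f n).hom x = 0 → (g.f n).hom x = 0) : ∃ l, f ≫ l = g := by
  refine ⟨Abelian.epiDesc f g ?_, Abelian.comp_epiDesc _ _ _⟩
  ext n t
  exact h n _ congr(($(kernel.condition f)).f n t)

/-! ### Intersections of subobjects and cointersections of quotients -/

section Intersections

variable {Λ : Type w} {B P : DgVect k} {A : Λ → DgVect k}

lemma exists_lift_tensorLeft (M : DgVect k) (φ : ∀ a, A a ⟶ B) (ι : P ⟶ B) [Mono ι]
    (hP : ∀ {T : DgVect k} (b : T ⟶ B) (x : ∀ a, T ⟶ A a), (∀ a, x a ≫ φ a = b) →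
      ∃ l, l ≫ ι = b) {T : DgVect k} (b : T ⟶ M ⊗ B) (x : ∀ a, T ⟶ M ⊗ A a)
    (h : ∀ a, x a ≫ M ◁ φ a = b) : ∃ l, l ≫ M ◁ ι = b := by
  -- Testing `hP` on disks: the image of `ι` contains the intersection of the images of the `φ a`.
  have hrange (q : ℤ) (z : B.X q) (hz : ∀ a, ∃ x, ((φ a).f q).hom x = z) :
      ∃ x, (ι.f q).hom x = z := by
    obtain ⟨D, e, he⟩ := exists_disk k q
    choose x hx using hz
    obtain ⟨l, hl⟩ := hP ((e B).symm z) (fun a => (e (A a)).symm (x a)) fun a =>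
      (e B).injective (by simp [he, hx])
    exact ⟨e P l, by rw [← he, hl, Equiv.apply_symm_apply]⟩
  have : Mono (M ◁ ι) := inferInstanceAs (Mono ((tensorLeft M).map ι))
  refine exists_lift_of_mono _ _ fun n t => ?_
  refine mem_of_tensorCoord (M := M) (V := B) (LinearMap.range ((M ◁ ι).f n).hom) _ fun i => ?_
  obtain ⟨y, hy⟩ := hrange _ (tensorCoord M B n ((b.f n).hom t) i) fun a => by
    refine ⟨tensorCoord M (A a) n (((x a).f n).hom t) i, ?_⟩
    rw [← tensorCoord_whiskerLeft, ← h a]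
    rfl
  exact ⟨basisTensor _ i y, by rw [whiskerLeft_basisTensor, hy]⟩

lemma exists_desc_tensorLeft (M : DgVect k) (φ : ∀ a, B ⟶ A a) [∀ a, Epi (φ a)] (π : B ⟶ P)
    [Epi π] (hP : ∀ {T : DgVect k} (b : B ⟶ T) (x : ∀ a, A a ⟶ T), (∀ a, φ a ≫ x a = b) →
      ∃ l, π ≫ l = b) {T : DgVect k} (b : M ⊗ B ⟶ T) (x : ∀ a, M ⊗ A a ⟶ T)
    (h : ∀ a, M ◁ φ a ≫ x a = b) : ∃ l, M ◁ π ≫ l = b := by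
  -- Testing `hP` on the codisk of the quotient of `B_q` by the sum of the kernels of the `φ a`:
  -- every `φ a` factors the projection, hence so does `π`.
  have hker (q : ℤ) :
      LinearMap.ker (π.f q).hom ≤ ⨆ a, LinearMap.ker ((φ a).f q).hom := by
    intro z hz
    let K : Submodule k (B.X q) := ⨆ a, LinearMap.ker ((φ a).f q).hom
    obtain ⟨D, e, he⟩ := exists_codisk (ModuleCat.of k (B.X q ⧸ K)) q
    have hfac (a : Λ) : ∃ l : (A a).X q ⟶ ModuleCat.of k (B.X q ⧸ K),
        (φ a).f q ≫ l = ModuleCat.ofHom K.mkQ := by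
      refine ⟨Abelian.epiDesc ((φ a).f q) (ModuleCat.ofHom K.mkQ) ?_,
        Abelian.comp_epiDesc _ _ _⟩
      ext x
      refine (Submodule.Quotient.mk_eq_zero K).2
        (le_iSup (fun a => LinearMap.ker ((φ a).f q).hom) a ?_)
      exact congr($(kernel.condition ((φ a).f q)) x)
    choose l hl using hfac
    obtain ⟨m, hm⟩ := hP ((e B).symm (ModuleCat.ofHom K.mkQ)) (fun a => (e (A a)).symm (l a))
      fun a => (e B).injective (by simp [he, hl])
    have hz' : (ModuleCat.ofHom K.mkQ).hom z = 0 := by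
      rw [← (e B).apply_symm_apply (ModuleCat.ofHom K.mkQ), ← hm, he, ModuleCat.hom_comp,
        LinearMap.comp_apply, LinearMap.mem_ker.1 hz, map_zero]
    exact (Submodule.Quotient.mk_eq_zero K).1 hz'
  have : Epi (M ◁ π) := inferInstanceAs (Epi ((tensorLeft M).map π))
  refine exists_desc_of_epi _ _ fun n y hy => ?_
  refine mem_of_tensorCoord (M := M) (V := B) (LinearMap.ker (b.f n).hom) y fun i => ?_
  have h₁ : tensorCoord M B n y i ∈ LinearMap.ker (π.f i.1.1.2).hom := by
    rw [LinearMap.mem_ker, ← tensorCoord_whiskerLeft, hy, map_zero, DFinsupp.zero_apply]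
  -- It is enough that `b` kills `b_i ⊗ ker (φ a)` for each `a`, where `b_i` is the basis vector of
  -- index `i`; this holds because `b` factors through `M ◁ φ a`.
  suffices (⨆ a, LinearMap.ker ((φ a).f i.1.1.2).hom) ≤
      (LinearMap.ker (b.f n).hom).comap (basisTensor B i) from this (hker _ h₁)
  refine iSup_le fun a x hx => ?_
  rw [Submodule.mem_comap, LinearMap.mem_ker, ← h a, comp_f, ModuleCat.hom_comp,
    LinearMap.comp_apply, whiskerLeft_basisTensor, LinearMap.mem_ker.1 hx, map_zero, map_zero]

/-- As the `M ◁ φ a` are monic, the leg of a cone at `B` determines the others, so only its lift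
through the mono `M ◁ ι` has to be found. -/
instance tensorLeft_preservesLimit_wideCospan (M : DgVect k) (φ : ∀ a, A a ⟶ B)
    [∀ a, Mono (φ a)] : PreservesLimit (WidePullbackShape.wideCospan B A φ) (tensorLeft M) where
  preserves {c} hc := by
    let ι : c.pt ⟶ B := c.π.app none
    let π (a : Λ) : c.pt ⟶ A a := c.π.app (some a)
    have hw (a : Λ) : π a ≫ φ a = ι := c.w (WidePullbackShape.Hom.term a)
    have : Mono ι := ⟨fun {T} g h hgh => hc.hom_ext fun j => by
      obtain _ | a := j
      · exact hgh
      · change g ≫ π a = h ≫ π a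
        rw [← cancel_mono (φ a), Category.assoc, Category.assoc, hw, hgh]⟩
    have : Mono (M ◁ ι) := inferInstanceAs (Mono ((tensorLeft M).map ι))
    have (a : Λ) : Mono (M ◁ φ a) := inferInstanceAs (Mono ((tensorLeft M).map _))
    have hlift (s : Cone (WidePullbackShape.wideCospan B A φ ⋙ tensorLeft M)) :
        ∃ l : s.pt ⟶ M ⊗ c.pt, l ≫ M ◁ ι = s.π.app none :=
      exists_lift_tensorLeft M φ ι
        (fun b x h => ⟨hc.lift (WidePullbackShape.mkCone b x h), hc.fac _ none⟩)
        (s.π.app none) (fun a => s.π.app (some a)) fun a => s.w (WidePullbackShape.Hom.term a)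
    choose lift hl using hlift
    refine ⟨{ lift := lift, fac := ?_, uniq := ?_ }⟩
    · intro s j
      obtain _ | a := j
      · exact hl s
      · refine (cancel_mono (M ◁ φ a)).1 ?_
        refine Eq.trans ?_ (s.w (WidePullbackShape.Hom.term a)).symm
        refine Eq.trans ?_ (hl s)
        change (lift s ≫ M ◁ π a) ≫ M ◁ φ a = lift s ≫ M ◁ ι
        rw [Category.assoc, ← MonoidalCategory.whiskerLeft_comp, hw]
    · intro s m hm
      exact (cancel_mono (M ◁ ι)).1 ((hm none).trans (hl s).symm)

instance tensorLeft_preservesColimit_wideSpan (M : DgVect k) (φ : ∀ a, B ⟶ A a)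
    [∀ a, Epi (φ a)] : PreservesColimit (WidePushoutShape.wideSpan B A φ) (tensorLeft M) where
  preserves {c} hc := by
    let π : B ⟶ c.pt := c.ι.app none
    let ι (a : Λ) : A a ⟶ c.pt := c.ι.app (some a)
    have hw (a : Λ) : φ a ≫ ι a = π := c.w (WidePushoutShape.Hom.init a)
    have : Epi π := ⟨fun {T} g h hgh => hc.hom_ext fun j => by
      obtain _ | a := j
      · exact hgh
      · change ι a ≫ g = ι a ≫ h
        rw [← cancel_epi (φ a), ← Category.assoc, ← Category.assoc, hw, hgh]⟩
    have : Epi (M ◁ π) := inferInstanceAs (Epi ((tensorLeft M).map π))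
    have (a : Λ) : Epi (M ◁ φ a) := inferInstanceAs (Epi ((tensorLeft M).map _))
    have hdesc (s : Cocone (WidePushoutShape.wideSpan B A φ ⋙ tensorLeft M)) :
        ∃ l : M ⊗ c.pt ⟶ s.pt, M ◁ π ≫ l = s.ι.app none :=
      exists_desc_tensorLeft M φ π
        (fun b x h => ⟨hc.desc (WidePushoutShape.mkCocone b x h), hc.fac _ none⟩)
        (s.ι.app none) (fun a => s.ι.app (some a)) fun a => s.w (WidePushoutShape.Hom.init a)
    choose desc hl using hdesc
    refine ⟨{ desc := desc, fac := ?_, uniq := ?_ }⟩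
    · intro s j
      obtain _ | a := j
      · exact hl s
      · refine (cancel_epi (M ◁ φ a)).1 ?_
        refine Eq.trans ?_ (s.w (WidePushoutShape.Hom.init a)).symm
        refine Eq.trans ?_ (hl s)
        change M ◁ φ a ≫ M ◁ ι a ≫ desc s = M ◁ π ≫ desc s
        rw [← MonoidalCategory.whiskerLeft_comp_assoc, hw]
    · intro s m hm
      exact (cancel_epi (M ◁ π)).1 ((hm none).trans (hl s).symm)

end Intersections

end DgVect

/-! ### Tensor powers and generated submonoids -/

namespace CategoryTheory.MonObj

variable {D : Type u} [Category.{v} D] [MonoidalCategory D]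

lemma tensorHom_one_mul {Y A : D} [MonObj A] (a : Y ⟶ A) :
    (a ⊗ₘ η[A]) ≫ μ[A] = (ρ_ Y).hom ≫ a := by
  rw [MonoidalCategory.tensorHom_def, Category.assoc, MonObj.mul_one, rightUnitor_naturality]

lemma one_tensorHom_mul {Y A : D} [MonObj A] (a : Y ⟶ A) :
    (η[A] ⊗ₘ a) ≫ μ[A] = (λ_ Y).hom ≫ a := by
  rw [MonoidalCategory.tensorHom_def', Category.assoc, MonObj.one_mul, leftUnitor_naturality]

lemma tensorHom_mul_tensorHom {Y Z W A : D} [MonObj A] (a : Y ⟶ A) (b : Z ⟶ A) (c : W ⟶ A) :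
    ((a ⊗ₘ b) ≫ μ[A] ⊗ₘ c) ≫ μ[A] =
      (α_ Y Z W).hom ≫ (a ⊗ₘ (b ⊗ₘ c) ≫ μ[A]) ≫ μ[A] := by
  have h₁ : ((a ⊗ₘ b) ≫ μ[A] ⊗ₘ c) = ((a ⊗ₘ b) ⊗ₘ c) ≫ μ[A] ▷ A := by
    rw [← tensorHom_id, tensorHom_comp_tensorHom, Category.comp_id]
  have h₂ : (a ⊗ₘ (b ⊗ₘ c) ≫ μ[A]) = (a ⊗ₘ (b ⊗ₘ c)) ≫ A ◁ μ[A] := by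
    rw [← id_tensorHom, tensorHom_comp_tensorHom, Category.comp_id]
  rw [h₁, h₂, Category.assoc, MonObj.mul_assoc, associator_naturality_assoc, Category.assoc]

/-- The tensor powers of an object, bracketed to the left. -/
def tensorPower (X : D) : ℕ → D
  | 0 => 𝟙_ D
  | n + 1 => tensorPower X n ⊗ X

/-- The morphism from a tensor power of `X` to a monoid that multiplies the values of `f`. -/
def tensorPowerHom {X A : D} [MonObj A] (f : X ⟶ A) : ∀ n, tensorPower X n ⟶ A
  | 0 => η[A]
  | n + 1 => (tensorPowerHom f n ⊗ₘ f) ≫ μ[A]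

/-- A product of `m` values of `f` times a product of `n` values is, by associativity, a product of
`m + n` values. This closes the image of all tensor powers under multiplication. -/
lemma exists_tensorPowerHom_mul {X A : D} [MonObj A] (f : X ⟶ A) (m n : ℕ) :
    ∃ g : tensorPower X m ⊗ tensorPower X n ⟶ tensorPower X (m + n),
      (tensorPowerHom f m ⊗ₘ tensorPowerHom f n) ≫ μ[A] = g ≫ tensorPowerHom f (m + n) := by
  induction n with
  | zero =>
    refine ⟨(ρ_ _).hom, ?_⟩
    change (tensorPowerHom f m ⊗ₘ η[A]) ≫ μ[A] = (ρ_ _).hom ≫ tensorPowerHom f m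
    exact tensorHom_one_mul _
  | succ n ih =>
    obtain ⟨g, hg⟩ := ih
    refine ⟨(α_ _ _ _).inv ≫ g ▷ X, ?_⟩
    change (tensorPowerHom f m ⊗ₘ (tensorPowerHom f n ⊗ₘ f) ≫ μ[A]) ≫ μ[A] =
      ((α_ _ _ _).inv ≫ g ▷ X) ≫ (tensorPowerHom f (m + n) ⊗ₘ f) ≫ μ[A]
    rw [Category.assoc, whiskerRight_comp_tensorHom_assoc, ← hg, tensorHom_mul_tensorHom,
      Iso.inv_hom_id_assoc]

/-- A mono into a monoid along which unit and multiplication restrict has a monoid structure. -/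
@[reducible]
def ofMono {A B : D} [MonObj A] (i : B ⟶ A) [Mono i] (one : 𝟙_ D ⟶ B) (mul : B ⊗ B ⟶ B)
    (h_one : one ≫ i = η[A]) (h_mul : mul ≫ i = (i ⊗ₘ i) ≫ μ[A]) : MonObj B where
  one := one
  mul := mul
  one_mul := by
    rw [← cancel_mono i, Category.assoc, h_mul, whiskerRight_comp_tensorHom_assoc, h_one,
      one_tensorHom_mul]
  mul_one := by
    rw [← cancel_mono i, Category.assoc, h_mul, whiskerLeft_comp_tensorHom_assoc, h_one,
      tensorHom_one_mul]
  mul_assoc := by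
    rw [← cancel_mono i, Category.assoc, Category.assoc, Category.assoc, h_mul,
      whiskerRight_comp_tensorHom_assoc, whiskerLeft_comp_tensorHom_assoc, h_mul,
      tensorHom_mul_tensorHom]

end CategoryTheory.MonObj

namespace CategoryTheory.Mon

open Opposite CategoryTheory.MonObj

variable {D : Type u} [Category.{v} D] [Abelian D] [MonoidalCategory D]

/-- The submonoid generated by a morphism `f : X ⟶ A`, as a quotient of a weak coproduct `T` of
the tensor powers of `X`. -/
lemma exists_submonoid [∀ M : D, (tensorLeft M).PreservesEpimorphisms]
    [∀ M : D, (tensorRight M).PreservesEpimorphisms] {X T : D}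
    (inc : ∀ n, tensorPower X n ⟶ T)
    (hT : ∀ {Z : D} (g : ∀ n, tensorPower X n ⟶ Z), ∃ e : T ⟶ Z, ∀ n, inc n ≫ e = g n)
    (hl : ∀ {M Z : D} (g h : M ⊗ T ⟶ Z), (∀ n, M ◁ inc n ≫ g = M ◁ inc n ≫ h) → g = h)
    (hr : ∀ {M Z : D} (g h : T ⊗ M ⟶ Z), (∀ n, inc n ▷ M ≫ g = inc n ▷ M ≫ h) → g = h)
    (A : D) [MonObj A] (f : X ⟶ A) :
    ∃ (S : Subobject (op T)) (i : unop (S : Dᵒᵖ) ⟶ A) (_ : MonObj (unop (S : Dᵒᵖ)))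
      (g : X ⟶ unop (S : Dᵒᵖ)), IsMonHom i ∧ g ≫ i = f := by
  obtain ⟨e, he⟩ := hT (tensorPowerHom f)
  -- The image of `e` is replaced by the chosen representative of its class among the quotients of
  -- `T`, so that the possible carriers form a set depending on `T` alone.
  let S : Subobject (op T) := Subobject.mk (factorThruImage e).op
  let B : D := unop (S : Dᵒᵖ)
  let π : T ⟶ B := S.arrow.unop
  let j : B ⟶ image e := (Subobject.underlyingIso (factorThruImage e).op).inv.unop
  let i : B ⟶ A := j ≫ image.ι e
  have hj : IsIso j :=
    inferInstanceAs (IsIso (Subobject.underlyingIso (factorThruImage e).op).inv.unop)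
  have hi : Mono i := mono_comp _ _
  have hπ : Epi π := inferInstanceAs (Epi (S.arrow).unop)
  have hπi : π ≫ i = e := by
    have : π ≫ j = factorThruImage e :=
      Quiver.Hom.op_inj (Subobject.underlyingIso_arrow (factorThruImage e).op)
    rw [← Category.assoc, this, image.fac]
  have he₀ : e ≫ cokernel.π i = 0 := by
    have : (π ≫ i) ≫ cokernel.π i = 0 := by simp
    rwa [hπi] at this
  have hππ : Epi (π ⊗ₘ π) := by
    have : Epi (π ▷ T) := inferInstanceAs (Epi ((tensorRight T).map π))
    have : Epi (B ◁ π) := inferInstanceAs (Epi ((tensorLeft B).map π))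
    rw [MonoidalCategory.tensorHom_def]
    exact epi_comp _ _
  -- The multiplication restricts to `B` once this composite vanishes. It can be tested on `T ⊗ T`,
  -- since `π ⊗ₘ π` is epic, and then on pairs of tensor powers by `hl` and `hr`; there the product
  -- factors through `e`.
  have hmul : ((i ⊗ₘ i) ≫ μ[A]) ≫ cokernel.π i = 0 := by
    rw [← cancel_epi (π ⊗ₘ π), comp_zero, Category.assoc, tensorHom_comp_tensorHom_assoc, hπi]
    refine hl _ _ fun n => ?_
    refine hr _ _ fun m => ?_
    obtain ⟨g, hg⟩ := exists_tensorPowerHom_mul f m n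
    rw [comp_zero, comp_zero, whiskerLeft_comp_tensorHom_assoc, he,
      whiskerRight_comp_tensorHom_assoc, he, reassoc_of% hg, ← he, Category.assoc, he₀,
      comp_zero, comp_zero]
  -- The first tensor power is `𝟙_ D ⊗ X` rather than `X`, hence the unitor in the map from `X` to
  -- `B` below.
  let u₀ : 𝟙_ D ⟶ T := inc 0
  let u₁ : 𝟙_ D ⊗ X ⟶ T := inc 1
  have hu₀ : u₀ ≫ e = η[A] := he 0
  have hu₁ : u₁ ≫ e = (η[A] ⊗ₘ f) ≫ μ[A] := he 1
  have hu₀' : (u₀ ≫ π) ≫ i = η[A] := by rw [Category.assoc, hπi, hu₀]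
  let mon : MonObj B :=
    MonObj.ofMono i (u₀ ≫ π) (Abelian.monoLift i _ hmul) hu₀' (Abelian.monoLift_comp _ _ _)
  refine ⟨S, i, mon, (λ_ X).inv ≫ u₁ ≫ π, ⟨hu₀', Abelian.monoLift_comp _ _ _⟩, ?_⟩
  rw [Category.assoc, Category.assoc, hπi, hu₁, one_tensorHom_mul, Iso.inv_hom_id_assoc]

/-- General adjoint functor theorem: the solution set for `X` consists of all monoid structures on
quotients of `T`, each with a map from `X`. Well-poweredness of `Dᵒᵖ` makes it small. -/
lemma forget_isRightAdjoint [HasLimits D] [WellPowered.{v} Dᵒᵖ]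
    [∀ M : D, (tensorLeft M).PreservesEpimorphisms]
    [∀ M : D, (tensorRight M).PreservesEpimorphisms]
    (h : ∀ A : ℕ → D, ∃ (T : D) (inc : ∀ n, A n ⟶ T),
      (∀ {Z : D} (g : ∀ n, A n ⟶ Z), ∃ e : T ⟶ Z, ∀ n, inc n ≫ e = g n) ∧
      (∀ {M Z : D} (g h : M ⊗ T ⟶ Z), (∀ n, M ◁ inc n ≫ g = M ◁ inc n ≫ h) → g = h) ∧
      (∀ {M Z : D} (g h : T ⊗ M ⟶ Z), (∀ n, inc n ▷ M ≫ g = inc n ▷ M ≫ h) → g = h)) :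
    (Mon.forget D).IsRightAdjoint := by
  have : HasLimits (Mon D) := ⟨fun J _ => inferInstance⟩
  have : PreservesLimits (Mon.forget D) := ⟨fun {J} _ => inferInstance⟩
  refine isRightAdjoint_of_preservesLimits_of_solutionSetCondition _ fun X => ?_
  obtain ⟨T, inc, hT, hl, hr⟩ := h (tensorPower X)
  have : Small.{v} (Subobject (op T)) := WellPowered.subobject_small (op T)
  let Q (S : Shrink.{v} (Subobject (op T))) : D :=
    unop (((equivShrink.{v} (Subobject (op T))).symm S : Subobject (op T)) : Dᵒᵖ)
  refine ⟨Σ S, MonObj (Q S) × (X ⟶ Q S), fun s => @Mon.mk _ _ _ (Q s.1) s.2.1, fun s => s.2.2, ?_⟩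
  intro A f
  obtain ⟨S, i, mon, g, hi, hg⟩ := exists_submonoid inc hT hl hr A.X f
  obtain ⟨S, rfl⟩ := (equivShrink.{v} (Subobject (op T))).symm.surjective S
  exact ⟨⟨S, mon, g⟩, Mon.Hom.mk i, hg⟩

end CategoryTheory.Mon

/-! ### Cofree comonoids by duality -/

namespace CategoryTheory.Comon

/-- Comonoids in `C` are, up to reversing arrows, monoids in `Cᵒᵖ`, and passing to opposites turns
right adjoints into left adjoints. -/
lemma forget_isLeftAdjoint (C : Type u) [Category.{v} C] [MonoidalCategory C]
    [(Mon.forget Cᵒᵖ).IsRightAdjoint] : (Comon.forget C).IsLeftAdjoint := by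
  have : (ComonToMonOpOp C).IsLeftAdjoint := (Comon_EquivMon_OpOp C).isLeftAdjoint_functor
  exact inferInstanceAs (ComonToMonOpOp C ⋙ (Mon.forget Cᵒᵖ).leftOp).IsLeftAdjoint

end CategoryTheory.Comon

/-- The first factor of a mono is monic, and abelian categories are balanced. -/
lemma CategoryTheory.Abelian.extremalMono_of_mono {C : Type u} [Category.{v} C] [Abelian C]
    {X Y : C} (f : X ⟶ Y) [Mono f] : ExtremalMono f where
  isIso π g fac _ := by
    have : Mono π := mono_of_mono_fac fac
    exact isIso_of_mono_of_epi π

lemma CategoryTheory.Abelian.extremalEpi_of_epi {C : Type u} [Category.{v} C] [Abelian C]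
    {X Y : C} (f : X ⟶ Y) [Epi f] : ExtremalEpi f where
  isIso p i fac _ := by
    have : Epi i := epi_of_epi_fac fac
    exact isIso_of_mono_of_epi i

/-! ### Verification of the conditions -/

namespace DgVect

open Opposite

variable {k : Type u} [Field k]

instance (M : DgVect k) {V W : DgVect k} (f : V ⟶ W) [Mono f] : Mono (M ◁ f) :=
  inferInstanceAs (Mono ((tensorLeft M).map f))

instance (M : DgVect k) {V W : DgVect k} (f : V ⟶ W) [Mono f] : Mono (f ▷ M) :=
  inferInstanceAs (Mono ((tensorRight M).map f))

instance (M : DgVect k) {V W : DgVect k} (f : V ⟶ W) [Epi f] : Epi (M ◁ f) :=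
  inferInstanceAs (Epi ((tensorLeft M).map f))

instance (M : DgVect k) {V W : DgVect k} (f : V ⟶ W) [Epi f] : Epi (f ▷ M) :=
  inferInstanceAs (Epi ((tensorRight M).map f))

lemma forgetMon_isRightAdjoint (k : Type u) [Field k] : (Mon.forget (DgVect k)).IsRightAdjoint := by
  refine Mon.forget_isRightAdjoint fun A => ⟨∐ fun n : ULift.{u} ℕ => A n.down,
    fun n => Sigma.ι (fun n : ULift.{u} ℕ => A n.down) ⟨n⟩,
    fun g => ⟨Sigma.desc fun n => g n.down, fun n => by simp⟩, fun g h hgh => ?_, fun g h hgh => ?_⟩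
  · exact tensorLeft_jointlyEpi (Sigma.ι fun n : ULift.{u} ℕ => A n.down)
      (fun _ _ H => Sigma.hom_ext _ _ H) g h fun n => hgh n.down
  · exact tensorRight_jointlyEpi (Sigma.ι fun n : ULift.{u} ℕ => A n.down)
      (fun _ _ H => Sigma.hom_ext _ _ H) g h fun n => hgh n.down

lemma forgetComon_isLeftAdjoint (k : Type u) [Field k] :
    (Comon.forget (DgVect k)).IsLeftAdjoint := by
  have (M : (DgVect k)ᵒᵖ) : (tensorLeft M).PreservesEpimorphisms := ⟨fun f _ =>
    inferInstanceAs (Epi (M.unop ◁ f.unop).op)⟩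
  have (M : (DgVect k)ᵒᵖ) : (tensorRight M).PreservesEpimorphisms := ⟨fun f _ =>
    inferInstanceAs (Epi (f.unop ▷ M.unop).op)⟩
  have : (Mon.forget (DgVect k)ᵒᵖ).IsRightAdjoint := by
    -- In the opposite category the product takes the place of the coproduct, and joint epicity
    -- after tensoring becomes joint monicity of the tensored projections.
    refine Mon.forget_isRightAdjoint fun A => ⟨op (∏ᶜ fun n : ULift.{u} ℕ => (A n.down).unop),
      fun n => (Pi.π (fun n : ULift.{u} ℕ => (A n.down).unop) ⟨n⟩).op,
      fun g => ⟨(Pi.lift fun n : ULift.{u} ℕ => (g n.down).unop).op, fun n => ?_⟩,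
      fun g h hgh => ?_, fun g h hgh => ?_⟩
    · exact Quiver.Hom.unop_inj (by simp)
    · exact Quiver.Hom.unop_inj
        (tensorLeft_jointlyMono (Pi.π fun n : ULift.{u} ℕ => (A n.down).unop)
          (fun _ _ H => Pi.hom_ext _ _ H) g.unop h.unop
          fun n => congrArg Quiver.Hom.unop (hgh n.down))
    · exact Quiver.Hom.unop_inj
        (tensorRight_jointlyMono (Pi.π fun n : ULift.{u} ℕ => (A n.down).unop)
          (fun _ _ H => Pi.hom_ext _ _ H) g.unop h.unop
          fun n => congrArg Quiver.Hom.unop (hgh n.down))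
  exact Comon.forget_isLeftAdjoint _

lemma baseConditions (k : Type u) [Field k] : BaseConditions.{w} (DgVect k) where
  limits := inferInstance
  finite_countable_colimits := ⟨inferInstance, ⟨fun J _ _ => inferInstance⟩⟩
  epi_extremalMono :=
    { factorization f := ⟨_, factorThruImage f, image.ι f, inferInstance,
        Abelian.extremalMono_of_mono _, image.fac f⟩
      diagonal π i _ _ := by
        have := strongEpi_of_epi π
        infer_instance }
  wellpowered := inferInstance
  cowellpowered := inferInstance
  mono_tensor f M _ := ⟨inferInstance, inferInstance⟩
  extremalMono_tensor f _ := by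
    have : Mono (f ⊗ₘ f) := by
      rw [MonoidalCategory.tensorHom_def]
      exact mono_comp _ _
    exact Abelian.extremalMono_of_mono _
  epi_tensor f M _ := ⟨inferInstance, inferInstance⟩
  tensorLeft_intersections M B Λ A φ _ := inferInstance
  tensorLeft_preimages M _ _ _ _ t h f g _ H := H.map (tensorLeft M)
  tensorLeft_products Λ _ M A _ _ := ⟨fun g h hgh =>
    tensorLeft_jointlyMono (Pi.π A) (fun _ _ H => Pi.hom_ext _ _ H) g h fun a => by
      simpa using congr($hgh ≫ Pi.π (fun a => M ⊗ A a) a)⟩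
  tensorLeft_equalizers M _ _ f g := inferInstance
  free_monoid := forgetMon_isRightAdjoint k

lemma dualBaseConditions (k : Type u) [Field k] : DualBaseConditions.{w} (DgVect k) where
  colimits := inferInstance
  finite_countable_limits := ⟨inferInstance, ⟨fun J _ _ => inferInstance⟩⟩
  extremalEpi_mono :=
    { factorization f := ⟨_, factorThruImage f, image.ι f, Abelian.extremalEpi_of_epi _,
        inferInstance, image.fac f⟩
      diagonal π i _ _ := by
        have := strongEpi_of_epi π
        infer_instance }
  wellpowered := inferInstance
  cowellpowered := inferInstance
  mono_tensor f M _ := ⟨inferInstance, inferInstance⟩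
  epi_tensor f M _ := ⟨inferInstance, inferInstance⟩
  extremalEpi_tensor f _ := by
    have : Epi (f ⊗ₘ f) := by
      rw [MonoidalCategory.tensorHom_def]
      exact epi_comp _ _
    exact Abelian.extremalEpi_of_epi _
  tensorRight_cointersections M A Λ B φ _ :=
    preservesColimit_of_natIso _ (tensorLeftIsoTensorRight M)
  tensorRight_pushouts M _ _ _ _ g f h t _ H := H.map (tensorRight M)
  tensorRight_coproducts Λ _ M A _ _ := ⟨fun g h hgh =>
    tensorRight_jointlyEpi (Sigma.ι A) (fun _ _ H => Sigma.hom_ext _ _ H) g h fun a => by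
      simpa using congr(Sigma.ι (fun a => A a ⊗ M) a ≫ $hgh)⟩
  tensorRight_coequalizers M _ _ f g := inferInstance
  cofree_comonoid := forgetComon_isLeftAdjoint k

end DgVect

theorem mainTheorem12 (k : Type u) [Field k] :
    (∃ S : SymmetricCategory (DgVect k),
      ∀ (U V : DgVect k) (p q n : ℤ) (h : p + q = n),
        HomologicalComplex.ιTensorObj U V p q n h ≫ (S.braiding U V).hom.f n =
          (p * q).negOnePow •
            ((β_ (U.X p) (V.X q)).hom ≫
              HomologicalComplex.ιTensorObj V U q p n ((add_comm q p).trans h))) ∧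
    BaseConditions.{w} (DgVect k) ∧
    DualBaseConditions.{w} (DgVect k) ∧
    (∀ {X Y : DgVect k} (f : X ⟶ Y), Mono f → ExtremalMono f) ∧
    (∀ {X Y : DgVect k} (f : X ⟶ Y), Epi f → ExtremalEpi f) :=
  ⟨⟨DgVect.symmetricCategory, DgVect.ι_koszulHom⟩, DgVect.baseConditions k,
    DgVect.dualBaseConditions k, fun f _ => Abelian.extremalMono_of_mono f,
    fun f _ => Abelian.extremalEpi_of_epi f⟩
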